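/- Let $X$ and $Y$ be completely regular Hausdorff spaces. For a topological space $Z$, a zero-set is a set $f^{-1}(0)$ with $f:Z\to\mathbb R$ continuous; $\mathcal U(Z)$ denotes the algebra and $\mathcal B_a(Z)$ the $\sigma$-algebra generated by the zero-sets, and $C_b(Z)$ the space of bounded continuous real functions. A Baire probability measure $\mu$ on $X$ (a countably additive probability measure on $\mathcal B_a(X)$) is called separable if for every bounded continuous pseudometric $d$ on $X$ it is concentrated on a subset of $X$ that has a countable $d$-dense subset. Let $\mathcal M^1(Z)$ be the set of non-negative finitely additive set functions $\gamma$ on $\mathcal U(Z)$ with $\gamma(Z)=1$ that are regular: for all $A\in\mathcal U(Z)$ and $\varepsilon>0$ there is a zero-set $F\subseteq A$ such that $\gamma(B)<\varepsilon$ for all $B\in\mathcal U(Z)$ with $B\subseteq A\setminus F$. Let $c:X\times Y\to\mathbb R$ be a bounded function with property (H): for all $x_0\in X$ and $y_0\in Y$, $$\lim_{x\to x_0}\sup_{y\in Y}|c(x,y)-c(x_0,y)|=0,\qquad \lim_{y\to y_0}\sup_{x\in X}|c(x,y)-c(x,y_0)|=0 .$$ Let $\mu$ and $\nu$ be separable Baire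 probability measures on $X$ and $Y$. Put $$\Gamma(\mu,\nu)=\Big\{\gamma\in\mathcal M^1(X\times Y):\ \int_{X\times Y}(\phi(x)+\psi(y))\,d\gamma=\int_X\phi\,d\mu+\int_Y\psi\,d\nu\ \ \forall\phi\in C_b(X),\ \forall\psi\in C_b(Y)\Big\},$$ $$v_{\min}(\mathrm{OP})=\inf\Big\{\int_{X\times Y} c\,d\gamma:\ \gamma\in\Gamma(\mu,\nu)\Big\},$$ $$v_{\max}(\mathrm{DP})=\sup\Big\{\int_X\phi\,d\mu+\int_Y\psi\,d\nu:\ \phi\in C_b(X),\ \psi\in C_b(Y),\ \phi(x)+\psi(y)\le c(x,y)\ \ \forall (x,y)\in X\times Y\Big\}.$$ For bounded $\xi:X\to\mathbb R$ and $\zeta:Y\to\mathbb R$ let $\xi^{c}(y)=\inf_{x\in X}(c(x,y)-\xi(x))$ and $\zeta^{\bar c}(x)=\inf_{y\in Y}(c(x,y)-\zeta(y))$, and write $\xi^{c\bar c}=(\xi^{c})^{\bar c}$. Then the infimum $v_{\min}(\mathrm{OP})$ is attained at some $\gamma^*\in\Gamma(\mu,\nu)$, and there is $\xi_0\in C_b(X)$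 such that $(\phi^*,\psi^*)=(\xi_0^{c\bar c},\xi_0^{c})$ belongs to $C_b(X)\times C_b(Y)$, satisfies $\phi^*(x)+\psi^*(y)\le c(x,y)$ for all $(x,y)$, and attains the supremum $v_{\max}(\mathrm{DP})$. Moreover $$\int_X\phi^*\,d\mu+\int_Y\psi^*\,d\nu=v_{\max}(\mathrm{DP})=v_{\min}(\mathrm{OP})=\int_{X\times Y}c\,d\gamma^* .$$ -/

import Mathlib

open MeasureTheory Topology Filter
open scoped BoundedContinuousFunction

noncomputable section

namespace BaireTransport

/-- The zero-sets of a topological space: the sets `f ⁻¹(0)` with `f` real-valued continuous. -/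
def zeroSets (Z : Type*) [TopologicalSpace Z] : Set (Set Z) :=
  {F | ∃ f : C(Z, ℝ), F = f ⁻¹' {0}}

/-- The algebra of sets generated by the zero-sets. -/
def zeroSetAlgebra (Z : Type*) [TopologicalSpace Z] : Set (Set Z) :=
  generateSetAlgebra (zeroSets Z)

/-- The measurable space structure on `X` is the Baire σ-algebra, that is, the σ-algebra generated
by the zero-sets (compare Mathlib's `BorelSpace`). A measure on `X` is then a Baire measure. -/
class BaireSigmaAlgebra (X : Type*) [TopologicalSpace X] [mX : MeasurableSpace X] : Prop where
  measurable_eq : mX = MeasurableSpace.generateFrom (zeroSets X)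

/-- Bounded continuous pseudometrics on a topological space. -/
structure IsBoundedContinuousPseudometric {X : Type*} [TopologicalSpace X] (d : X → X → ℝ) :
    Prop where
  nonneg : ∀ x y, 0 ≤ d x y
  self : ∀ x, d x x = 0
  symm : ∀ x y, d x y = d y x
  triangle : ∀ x y z, d x z ≤ d x y + d y z
  continuous : Continuous fun p : X × X => d p.1 p.2
  bounded : ∃ M : ℝ, ∀ x y, d x y ≤ M

/-- A (Baire) measure is separable if, for every bounded continuous pseudometric `d`, it is
concentrated on a subset that has a countable `d`-dense subset. -/
def IsSeparableMeasure {X : Type*} [TopologicalSpace X] [MeasurableSpace X] (μ : Measure X) :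
    Prop :=
  ∀ d : X → X → ℝ, IsBoundedContinuousPseudometric d →
    ∃ S : Set X, μ Sᶜ = 0 ∧
      ∃ D : Set X, D ⊆ S ∧ D.Countable ∧ ∀ x ∈ S, ∀ ε > 0, ∃ a ∈ D, d x a < ε

/-- Non-negative, finitely additive, zero-set regular set functions of total mass `1` on the algebra
generated by the zero-sets. (An `AddContent` is a function on all sets, but only its values on the
algebra are constrained, and only these are used.) -/
structure ProbabilityCharge (Z : Type*) [TopologicalSpace Z] where
  /-- the underlying finitely additive set function -/
  content : AddContent ℝ (zeroSetAlgebra Z)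
  nonneg : ∀ A ∈ zeroSetAlgebra Z, 0 ≤ content A
  regular : ∀ A ∈ zeroSetAlgebra Z, ∀ ε > 0, ∃ F ∈ zeroSets Z, F ⊆ A ∧
    ∀ B ∈ zeroSetAlgebra Z, B ⊆ A \ F → |content B| < ε
  mass : content Set.univ = 1

/-- The integrals of the simple functions below `f`: the sums `∑ aᵢ γ(Aᵢ)` over the finite
partitions of `Z` into sets `Aᵢ` of the algebra, where `aᵢ ≤ f` on `Aᵢ`. -/
def ProbabilityCharge.lowerSums {Z : Type*} [TopologicalSpace Z] (γ : ProbabilityCharge Z)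
    (f : Z → ℝ) : Set ℝ :=
  {r | ∃ (n : ℕ) (A : Fin n → Set Z) (a : Fin n → ℝ),
    (∀ i, A i ∈ zeroSetAlgebra Z) ∧ Pairwise (Function.onFun Disjoint A) ∧
    (⋃ i, A i) = Set.univ ∧ (∀ i, ∀ z ∈ A i, a i ≤ f z) ∧
    r = ∑ i, a i * γ.content (A i)}

/-- The integral of a bounded function against a charge, as the supremum of the integrals of the
simple functions below it. A bounded continuous `f` is a uniform limit of simple functions over the
algebra, so for such `f` this is also the infimum of the integrals of the simple functions above
`f`, and the limit of the integrals of any simple functions that converge uniformly to `f`. -/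
def ProbabilityCharge.integral {Z : Type*} [TopologicalSpace Z] (γ : ProbabilityCharge Z)
    (f : Z → ℝ) : ℝ :=
  sSup (γ.lowerSums f)

variable {X Y : Type*}

/-- The set `Γ(μ, ν)`. -/
def plans [TopologicalSpace X] [TopologicalSpace Y] [MeasurableSpace X] [MeasurableSpace Y]
    (μ : Measure X) (ν : Measure Y) : Set (ProbabilityCharge (X × Y)) :=
  {γ | ∀ (φ : X →ᵇ ℝ) (ψ : Y →ᵇ ℝ),
    γ.integral (fun p => φ p.1 + ψ p.2) = ∫ x, φ x ∂μ + ∫ y, ψ y ∂ν}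

/-- The value of the problem (OP). -/
def valueOP [TopologicalSpace X] [TopologicalSpace Y] [MeasurableSpace X] [MeasurableSpace Y]
    (c : X × Y → ℝ) (μ : Measure X) (ν : Measure Y) : ℝ :=
  sInf ((fun γ : ProbabilityCharge (X × Y) => γ.integral c) '' plans μ ν)

/-- The admissible pairs of the dual problem (DP). -/
def dualAdmissible [TopologicalSpace X] [TopologicalSpace Y] (c : X × Y → ℝ) :
    Set ((X →ᵇ ℝ) × (Y →ᵇ ℝ)) :=
  {q | ∀ x y, q.1 x + q.2 y ≤ c (x, y)}

/-- The objective of the dual problem (DP). -/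
def dualObjective [TopologicalSpace X] [TopologicalSpace Y] [MeasurableSpace X] [MeasurableSpace Y]
    (μ : Measure X) (ν : Measure Y) (q : (X →ᵇ ℝ) × (Y →ᵇ ℝ)) : ℝ :=
  ∫ x, q.1 x ∂μ + ∫ y, q.2 y ∂ν

/-- The value of the dual problem (DP). -/
def valueDP [TopologicalSpace X] [TopologicalSpace Y] [MeasurableSpace X] [MeasurableSpace Y]
    (c : X × Y → ℝ) (μ : Measure X) (ν : Measure Y) : ℝ :=
  sSup (dualObjective μ ν '' dualAdmissible c)

/-- The `c`-transform `ξ^c` of a function on `X`. -/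
def cTransform (c : X × Y → ℝ) (ξ : X → ℝ) : Y → ℝ :=
  fun y => ⨅ x, (c (x, y) - ξ x)

/-- The transform of a function on `Y` with the variables of `c` exchanged. -/
def cBarTransform (c : X × Y → ℝ) (ζ : Y → ℝ) : X → ℝ :=
  fun x => ⨅ y, (c (x, y) - ζ y)

/-- Property (H). -/
def PropertyH [TopologicalSpace X] [TopologicalSpace Y] (c : X × Y → ℝ) : Prop :=
  (∀ x₀ : X, Tendsto (fun x => ⨆ y, |c (x, y) - c (x₀, y)|) (𝓝 x₀) (𝓝 0)) ∧
  (∀ y₀ : Y, Tendsto (fun y => ⨆ x, |c (x, y) - c (x, y₀)|) (𝓝 y₀) (𝓝 0))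

end BaireTransport

end

open BaireTransport

/-!
The value `v_max(DP)` is a superlinear function of the cost, so by Hahn–Banach some linear
functional `L ≥ v_max(DP)` on the bounded continuous functions agrees with it at `c`. Such an `L`
is positive and has marginals `μ` and `ν`. By Alexandroff's theorem `L` is the integral of a
regular charge, whose mass on a zero-set `F` is the infimum of `L f` over the continuous `f ≥ 1_F`;
this charge is a transport plan of cost `v_max(DP)`, and weak duality makes it optimal.

The attainment in (DP) rests on convexity. By (H), `c`-transforms improve every admissible pair, up
to a constant shift between its two entries, to one in a uniformly bounded and equicontinuous convex
family. The near-maximizers in this family form a decreasing sequence of convex sets `Kₙ`, bounded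
in `L²(μ × ν)`, so their near-minimal-norm elements are Cauchy and have a subsequence converging
almost everywhere. By equicontinuity a pointwise limit along an ultrafilter is a pair of continuous
functions; it has the same almost everywhere limit, and dominated convergence shows that it is a
maximizer.
-/

noncomputable section

namespace BaireTransport

section ZeroSets

variable {Z : Type*} [TopologicalSpace Z] {F G : Set Z} {f : Z → ℝ}

theorem setOf_le_mem_zeroSets (hf : Continuous f) (a : ℝ) : {z | f z ≤ a} ∈ zeroSets Z :=
  ⟨⟨fun z => max (f z - a) 0, by fun_prop⟩, by ext z; simp⟩

theorem setOf_ge_mem_zeroSets (hf : Continuous f) (a : ℝ) : {z | a ≤ f z} ∈ zeroSets Z := by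
  simpa using setOf_le_mem_zeroSets hf.neg (-a)

theorem empty_mem_zeroSets : (∅ : Set Z) ∈ zeroSets Z :=
  ⟨1, by ext z; simp⟩

theorem univ_mem_zeroSets : (Set.univ : Set Z) ∈ zeroSets Z :=
  ⟨0, by ext z; simp⟩

theorem union_mem_zeroSets (hF : F ∈ zeroSets Z) (hG : G ∈ zeroSets Z) : F ∪ G ∈ zeroSets Z := by
  obtain ⟨f, rfl⟩ := hF
  obtain ⟨g, rfl⟩ := hG
  exact ⟨f * g, by ext z; simp⟩

theorem inter_mem_zeroSets (hF : F ∈ zeroSets Z) (hG : G ∈ zeroSets Z) : F ∩ G ∈ zeroSets Z := by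
  obtain ⟨f, rfl⟩ := hF
  obtain ⟨g, rfl⟩ := hG
  refine ⟨⟨fun z => |f z| + |g z|, by fun_prop⟩, ?_⟩
  ext z
  simp [add_eq_zero_iff_of_nonneg (abs_nonneg (f z)) (abs_nonneg (g z))]

theorem biUnion_mem_zeroSets {ι : Type*} (t : Finset ι) {F : ι → Set Z}
    (hF : ∀ i ∈ t, F i ∈ zeroSets Z) : (⋃ i ∈ t, F i) ∈ zeroSets Z := by
  classical
  induction t using Finset.induction_on with
  | empty => simpa using empty_mem_zeroSets
  | insert i t _ ih =>
    rw [Finset.set_biUnion_insert]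
    exact union_mem_zeroSets (hF i (Finset.mem_insert_self i t))
      (ih fun j hj => hF j (Finset.mem_insert_of_mem hj))

theorem isSetAlgebra_zeroSetAlgebra : IsSetAlgebra (zeroSetAlgebra Z) :=
  isSetAlgebra_generateSetAlgebra

theorem zeroSets_subset_zeroSetAlgebra : zeroSets Z ⊆ zeroSetAlgebra Z :=
  self_subset_generateSetAlgebra

theorem exists_separating_of_disjoint_zeroSets (hF : F ∈ zeroSets Z) (hG : G ∈ zeroSets Z)
    (h : Disjoint F G) :
    ∃ s : Z →ᵇ ℝ, (∀ z, 0 ≤ s z) ∧ (∀ z, s z ≤ 1) ∧ (∀ z ∈ F, s z = 0) ∧ ∀ z ∈ G, s z = 1 := by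
  obtain ⟨f, rfl⟩ := hF
  obtain ⟨g, rfl⟩ := hG
  have hpos : ∀ z, 0 < |f z| + |g z| := fun z => by
    refine (by positivity : 0 ≤ |f z| + |g z|).lt_of_ne' fun hz => ?_
    rw [add_eq_zero_iff_of_nonneg (abs_nonneg _) (abs_nonneg _), abs_eq_zero, abs_eq_zero] at hz
    exact Set.disjoint_left.mp h hz.1 hz.2
  have h0 : ∀ z, 0 ≤ |f z| / (|f z| + |g z|) := fun z => by positivity
  have h1 : ∀ z, |f z| / (|f z| + |g z|) ≤ 1 := fun z =>
    (div_le_one (hpos z)).mpr (le_add_of_nonneg_right (abs_nonneg _))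
  refine ⟨.ofNormedAddCommGroup (fun z => |f z| / (|f z| + |g z|))
    (Continuous.div (by fun_prop) (by fun_prop) fun z => (hpos z).ne') 1
    fun z => (abs_of_nonneg (h0 z)).trans_le (h1 z), h0, h1, fun z hz => ?_, fun z hz => ?_⟩
  · have hf : f z = 0 := hz
    simp [hf]
  · have hg : g z = 0 := hz
    have hfz : |f z| ≠ 0 := by simpa only [hg, abs_zero, add_zero] using (hpos z).ne'
    simp [hg, hfz]

theorem setOf_floor_eq_mem_zeroSetAlgebra (hf : Continuous f) (hf0 : ∀ z, 0 ≤ f z) (n : ℕ) :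
    {z | ⌊f z⌋₊ = n} ∈ zeroSetAlgebra Z := by
  have h : {z | ⌊f z⌋₊ = n} = {z | (n : ℝ) ≤ f z} \ {z | (n + 1 : ℝ) ≤ f z} := by
    ext z
    simp [Nat.floor_eq_iff (hf0 z)]
  rw [h]
  exact isSetAlgebra_zeroSetAlgebra.sdiff_mem
    (zeroSets_subset_zeroSetAlgebra (setOf_ge_mem_zeroSets hf _))
    (zeroSets_subset_zeroSetAlgebra (setOf_ge_mem_zeroSets hf _))

theorem exists_partition_oscillation_le (f : Z →ᵇ ℝ) {ε : ℝ} (hε : 0 < ε) :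
    ∃ (n : ℕ) (A : Fin n → Set Z) (a : Fin n → ℝ), (∀ i, A i ∈ zeroSetAlgebra Z) ∧
      Pairwise (Function.onFun Disjoint A) ∧ (⋃ i, A i) = Set.univ ∧
      ∀ i, ∀ z ∈ A i, a i ≤ f z ∧ f z ≤ a i + ε := by
  set g : Z → ℝ := fun z => (f z + ‖f‖) / ε with hg
  have hg0 : ∀ z, 0 ≤ g z := fun z =>
    div_nonneg (by linarith [f.neg_norm_le_apply z]) hε.le
  have hgM : ∀ z, g z ≤ (‖f‖ + ‖f‖) / ε := fun z => by
    simp only [hg]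
    gcongr
    exact f.apply_le_norm z
  refine ⟨⌊(‖f‖ + ‖f‖) / ε⌋₊ + 1, fun i => {z | ⌊g z⌋₊ = i}, fun i => i * ε - ‖f‖,
    fun i => setOf_floor_eq_mem_zeroSetAlgebra (by fun_prop) hg0 i, fun i j hij => ?_, ?_,
    fun i z hz => ?_⟩
  · exact Set.disjoint_left.mpr fun z hi hj => hij (Fin.ext (hi.symm.trans hj))
  · exact Set.eq_univ_of_forall fun z => Set.mem_iUnion.mpr
      ⟨⟨⌊g z⌋₊, Nat.lt_succ_of_le (Nat.floor_mono (hgM z))⟩, rfl⟩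
  · obtain ⟨h1, h2⟩ := (Nat.floor_eq_iff (hg0 z)).mp hz
    rw [hg, le_div_iff₀ hε] at h1
    rw [hg, div_lt_iff₀ hε] at h2
    constructor <;> linarith

end ZeroSets

section Representation

variable {Z : Type*} [TopologicalSpace Z]

/-- The mass that a positive functional gives to a zero-set: the infimum of its values on the
non-negative functions that are at least `1` there. -/
def zeroSetMass (L : (Z →ᵇ ℝ) →ₚ[ℝ] ℝ) (F : Set Z) : ℝ :=
  sInf (L '' {f | 0 ≤ f ∧ ∀ z ∈ F, 1 ≤ f z})

/-- The inner mass of a set: the supremum of the masses of the zero-sets it contains. -/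
def innerMass (L : (Z →ᵇ ℝ) →ₚ[ℝ] ℝ) (A : Set Z) : ℝ :=
  sSup (zeroSetMass L '' {F | F ∈ zeroSets Z ∧ F ⊆ A})

variable (L : (Z →ᵇ ℝ) →ₚ[ℝ] ℝ) {F G A B : Set Z} {f : Z →ᵇ ℝ}

theorem zeroSetMass_le (h0 : 0 ≤ f) (h1 : ∀ z ∈ F, 1 ≤ f z) : zeroSetMass L F ≤ L f :=
  csInf_le ⟨0, by rintro _ ⟨f, hf, rfl⟩; exact map_nonneg L hf.1⟩ ⟨f, ⟨h0, h1⟩, rfl⟩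

theorem le_zeroSetMass {r : ℝ} (h : ∀ f : Z →ᵇ ℝ, 0 ≤ f → (∀ z ∈ F, 1 ≤ f z) → r ≤ L f) :
    r ≤ zeroSetMass L F :=
  le_csInf ⟨L 1, 1, ⟨fun _ => zero_le_one, fun _ _ => le_rfl⟩, rfl⟩ fun _ ⟨f, hf, hr⟩ =>
    hr ▸ h f hf.1 hf.2

theorem exists_apply_lt_zeroSetMass_add (F : Set Z) {ε : ℝ} (hε : 0 < ε) :
    ∃ f : Z →ᵇ ℝ, 0 ≤ f ∧ (∀ z ∈ F, 1 < f z) ∧ L f < zeroSetMass L F + ε := by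
  obtain ⟨f, h0, h1, hf⟩ : ∃ f : Z →ᵇ ℝ, 0 ≤ f ∧ (∀ z ∈ F, 1 ≤ f z) ∧
      L f < zeroSetMass L F + ε / 2 := by
    by_contra! h
    linarith [le_zeroSetMass L h]
  obtain ⟨δ, hδ, hδL⟩ := exists_pos_mul_lt (half_pos hε) (L 1)
  refine ⟨f + δ • 1, add_nonneg h0 fun _ => mul_nonneg hδ.le zero_le_one, fun z hz => ?_, ?_⟩
  · simpa using lt_add_of_le_of_pos (h1 z hz) hδ
  · rw [map_add, map_smul, smul_eq_mul]
    linarith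

theorem zeroSetMass_nonneg (F : Set Z) : 0 ≤ zeroSetMass L F :=
  le_zeroSetMass L fun _ h0 _ => map_nonneg L h0

theorem zeroSetMass_empty : zeroSetMass L ∅ = 0 :=
  le_antisymm ((zeroSetMass_le L le_rfl fun _ hz => hz.elim).trans_eq (map_zero L))
    (zeroSetMass_nonneg L ∅)

theorem zeroSetMass_univ : zeroSetMass L Set.univ = L 1 :=
  le_antisymm (zeroSetMass_le L (fun _ => zero_le_one) fun _ _ => le_rfl) <|
    le_zeroSetMass L fun _ _ h1 => OrderHomClass.mono L fun z => h1 z trivial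

theorem zeroSetMass_mono (h : F ⊆ G) : zeroSetMass L F ≤ zeroSetMass L G :=
  le_zeroSetMass L fun _ h0 h1 => zeroSetMass_le L h0 fun z hz => h1 z (h hz)

theorem zeroSetMass_le_apply_one (F : Set Z) : zeroSetMass L F ≤ L 1 :=
  zeroSetMass_le L (fun _ => zero_le_one) fun _ _ => le_rfl

theorem mul_zeroSetMass_le {a : ℝ} (ha : 0 ≤ a) (h0 : 0 ≤ f) (h1 : ∀ z ∈ F, a ≤ f z) :
    a * zeroSetMass L F ≤ L f := by
  rcases ha.eq_or_lt with rfl | ha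
  · simpa using map_nonneg L h0
  · have h := zeroSetMass_le L (F := F) (f := a⁻¹ • f)
      (fun z => mul_nonneg (inv_nonneg.mpr ha.le) (h0 z)) fun z hz => by
        simpa [← div_eq_inv_mul, one_le_div ha] using h1 z hz
    rwa [map_smul, smul_eq_mul, ← div_eq_inv_mul, le_div_iff₀' ha] at h

theorem zeroSetMass_union_le (F G : Set Z) :
    zeroSetMass L (F ∪ G) ≤ zeroSetMass L F + zeroSetMass L G := by
  refine le_of_forall_pos_le_add fun ε hε => ?_
  obtain ⟨f, f0, f1, hf⟩ := exists_apply_lt_zeroSetMass_add L F (half_pos hε)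
  obtain ⟨g, g0, g1, hg⟩ := exists_apply_lt_zeroSetMass_add L G (half_pos hε)
  have h := zeroSetMass_le L (F := F ∪ G) (add_nonneg f0 g0) (by
    rintro z (hz | hz)
    · exact (f1 z hz).le.trans (le_add_of_nonneg_right (g0 z))
    · exact (g1 z hz).le.trans (le_add_of_nonneg_left (f0 z)))
  rw [map_add] at h
  linarith

/-- If `f ≥ 1` on `F ∪ G` and `g > 1` on `F ∩ G`, then `F ∩ {g ≤ 1}` and `G ∩ {g ≤ 1}` are
disjoint, and a function `s` separating them splits `f + g` into a majorant of `F` and one of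
`G`. -/
theorem zeroSetMass_add_le_of_majorants (hF : F ∈ zeroSets Z) (hG : G ∈ zeroSets Z)
    {g : Z →ᵇ ℝ} (f0 : 0 ≤ f) (g0 : 0 ≤ g) (f1 : ∀ z ∈ F ∪ G, 1 ≤ f z)
    (g1 : ∀ z ∈ F ∩ G, 1 < g z) : zeroSetMass L F + zeroSetMass L G ≤ L f + L g := by
  obtain ⟨s, s0, s1, sF, sG⟩ := exists_separating_of_disjoint_zeroSets
    (inter_mem_zeroSets hF (setOf_le_mem_zeroSets g.continuous 1))
    (inter_mem_zeroSets hG (setOf_le_mem_zeroSets g.continuous 1))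
    (Set.disjoint_left.mpr fun z hzF hzG => (g1 z ⟨hzF.1, hzG.1⟩).not_ge hzF.2)
  have one_le_convex : ∀ {t a b : ℝ}, 0 ≤ t → t ≤ 1 → 1 ≤ a → 1 ≤ b →
      1 ≤ (1 - t) * a + t * b := fun ht0 ht1 ha hb => by nlinarith
  have hF' : zeroSetMass L F ≤ L ((1 - s) * f + s * g) := by
    refine zeroSetMass_le L (fun z => ?_) fun z hz => ?_
    · exact add_nonneg (mul_nonneg (sub_nonneg.mpr (s1 z)) (f0 z)) (mul_nonneg (s0 z) (g0 z))
    · have hfz := f1 z (Or.inl hz)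
      rcases le_total (g z) 1 with hgz | hgz
      · simpa [sF z ⟨hz, hgz⟩] using hfz
      · exact one_le_convex (s0 z) (s1 z) hfz hgz
  have hG' : zeroSetMass L G ≤ L ((1 - s) * g + s * f) := by
    refine zeroSetMass_le L (fun z => ?_) fun z hz => ?_
    · exact add_nonneg (mul_nonneg (sub_nonneg.mpr (s1 z)) (g0 z)) (mul_nonneg (s0 z) (f0 z))
    · have hfz := f1 z (Or.inr hz)
      rcases le_total (g z) 1 with hgz | hgz
      · simpa [sG z ⟨hz, hgz⟩] using hfz
      · exact one_le_convex (s0 z) (s1 z) hgz hfz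
  calc zeroSetMass L F + zeroSetMass L G
      ≤ L ((1 - s) * f + s * g) + L ((1 - s) * g + s * f) := add_le_add hF' hG'
    _ = L f + L g := by rw [← map_add, ← map_add]; congr 1; ring

theorem zeroSetMass_supermodular (hF : F ∈ zeroSets Z) (hG : G ∈ zeroSets Z) :
    zeroSetMass L F + zeroSetMass L G ≤ zeroSetMass L (F ∪ G) + zeroSetMass L (F ∩ G) := by
  refine le_of_forall_pos_le_add fun ε hε => ?_
  obtain ⟨f, f0, f1, hf⟩ := exists_apply_lt_zeroSetMass_add L (F ∪ G) (half_pos hε)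
  obtain ⟨g, g0, g1, hg⟩ := exists_apply_lt_zeroSetMass_add L (F ∩ G) (half_pos hε)
  linarith [zeroSetMass_add_le_of_majorants L hF hG f0 g0 (fun z hz => (f1 z hz).le) g1]

theorem exists_zeroSet_subset_compl (F : Set Z) {ε : ℝ} (hε : 0 < ε) :
    ∃ G ∈ zeroSets Z, G ⊆ Fᶜ ∧ L 1 ≤ zeroSetMass L F + zeroSetMass L G + ε := by
  obtain ⟨f, f0, f1, hf⟩ := exists_apply_lt_zeroSetMass_add L F hε
  refine ⟨{z | f z ≤ 1}, setOf_le_mem_zeroSets f.continuous 1,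
    fun z hz hzF => (f1 z hzF).not_ge hz, ?_⟩
  have h : L 1 - L f ≤ zeroSetMass L {z | f z ≤ 1} := le_zeroSetMass L fun g g0 g1 => by
    rw [sub_le_iff_le_add, ← map_add]
    refine OrderHomClass.mono L fun z => ?_
    rcases le_total (f z) 1 with hz | hz
    · exact (g1 z hz).trans (le_add_of_nonneg_right (f0 z))
    · exact hz.trans (le_add_of_nonneg_left (g0 z))
  linarith

theorem zeroSetMass_le_innerMass (hF : F ∈ zeroSets Z) (h : F ⊆ A) :
    zeroSetMass L F ≤ innerMass L A :=
  le_csSup ⟨L 1, by rintro _ ⟨F, -, rfl⟩; exact zeroSetMass_le_apply_one L F⟩ ⟨F, ⟨hF, h⟩, rfl⟩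

theorem innerMass_le {r : ℝ} (h : ∀ F ∈ zeroSets Z, F ⊆ A → zeroSetMass L F ≤ r) :
    innerMass L A ≤ r :=
  csSup_le ⟨_, ∅, ⟨empty_mem_zeroSets, Set.empty_subset A⟩, rfl⟩
    fun _ ⟨F, hF, hr⟩ => hr ▸ h F hF.1 hF.2

theorem exists_innerMass_sub_lt (A : Set Z) {ε : ℝ} (hε : 0 < ε) :
    ∃ F ∈ zeroSets Z, F ⊆ A ∧ innerMass L A - ε < zeroSetMass L F := by
  by_contra! h
  linarith [innerMass_le L h]

theorem innerMass_mono (h : A ⊆ B) : innerMass L A ≤ innerMass L B :=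
  innerMass_le L fun _ hF hFA => zeroSetMass_le_innerMass L hF (hFA.trans h)

theorem innerMass_of_zeroSet (hF : F ∈ zeroSets Z) : innerMass L F = zeroSetMass L F :=
  le_antisymm (innerMass_le L fun _ _ h => zeroSetMass_mono L h)
    (zeroSetMass_le_innerMass L hF subset_rfl)

theorem innerMass_empty : innerMass L ∅ = 0 := by
  rw [innerMass_of_zeroSet L empty_mem_zeroSets, zeroSetMass_empty]

theorem innerMass_univ : innerMass L Set.univ = L 1 := by
  rw [innerMass_of_zeroSet L univ_mem_zeroSets, zeroSetMass_univ]

theorem innerMass_nonneg (A : Set Z) : 0 ≤ innerMass L A :=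
  (innerMass_empty L).symm.trans_le (innerMass_mono L (Set.empty_subset A))

theorem innerMass_supermodular (A B : Set Z) :
    innerMass L A + innerMass L B ≤ innerMass L (A ∪ B) + innerMass L (A ∩ B) := by
  refine le_of_forall_pos_le_add fun ε hε => ?_
  obtain ⟨F, hF, hFA, h1⟩ := exists_innerMass_sub_lt L A (half_pos hε)
  obtain ⟨G, hG, hGB, h2⟩ := exists_innerMass_sub_lt L B (half_pos hε)
  linarith [zeroSetMass_supermodular L hF hG,
    zeroSetMass_le_innerMass L (union_mem_zeroSets hF hG) (Set.union_subset_union hFA hGB),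
    zeroSetMass_le_innerMass L (inter_mem_zeroSets hF hG) (Set.inter_subset_inter hFA hGB)]

theorem innerMass_add_le_union (h : Disjoint A B) :
    innerMass L A + innerMass L B ≤ innerMass L (A ∪ B) := by
  simpa only [h.inter_eq, innerMass_empty, add_zero] using innerMass_supermodular L A B

theorem innerMass_add_compl_le (A : Set Z) : innerMass L A + innerMass L Aᶜ ≤ L 1 := by
  simpa only [Set.union_compl_self, innerMass_univ] using
    innerMass_add_le_union L (disjoint_compl_right (a := A))

theorem innerMass_add_compl_union (hA : innerMass L A + innerMass L Aᶜ = L 1)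
    (hB : innerMass L B + innerMass L Bᶜ = L 1) :
    innerMass L (A ∪ B) + innerMass L (A ∪ B)ᶜ = L 1 := by
  refine le_antisymm (innerMass_add_compl_le L _) (le_of_forall_pos_le_add fun ε hε => ?_)
  have hε4 : 0 < ε / 4 := by positivity
  obtain ⟨F, hF, hFA, h1⟩ := exists_innerMass_sub_lt L A hε4
  obtain ⟨F', hF', hFA', h1'⟩ := exists_innerMass_sub_lt L Aᶜ hε4
  obtain ⟨G, hG, hGB, h2⟩ := exists_innerMass_sub_lt L B hε4
  obtain ⟨G', hG', hGB', h2'⟩ := exists_innerMass_sub_lt L Bᶜ hε4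
  have hFF' : zeroSetMass L F + zeroSetMass L F' ≤ zeroSetMass L (F ∪ F') := by
    simpa only [(disjoint_compl_right.mono hFA hFA').inter_eq, zeroSetMass_empty, add_zero]
      using zeroSetMass_supermodular L hF hF'
  have hGG' : zeroSetMass L G + zeroSetMass L G' ≤ zeroSetMass L (G ∪ G') := by
    simpa only [(disjoint_compl_right.mono hGB hGB').inter_eq, zeroSetMass_empty, add_zero]
      using zeroSetMass_supermodular L hG hG'
  have hsub : (F ∪ F') ∩ (G ∪ G') ⊆ F ∪ G ∪ F' ∩ G' := by
    rintro z ⟨h | h, h' | h'⟩ <;> simp [h, h']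
  linarith [zeroSetMass_supermodular L (union_mem_zeroSets hF hF') (union_mem_zeroSets hG hG'),
    zeroSetMass_le_apply_one L (F ∪ F' ∪ (G ∪ G')),
    (zeroSetMass_mono L hsub).trans (zeroSetMass_union_le L (F ∪ G) (F' ∩ G')),
    zeroSetMass_le_innerMass L (union_mem_zeroSets hF hG) (Set.union_subset_union hFA hGB),
    zeroSetMass_le_innerMass L (inter_mem_zeroSets hF' hG') (A := (A ∪ B)ᶜ)
      (by rw [Set.compl_union]; exact Set.inter_subset_inter hFA' hGB')]

theorem innerMass_add_compl (hA : A ∈ zeroSetAlgebra Z) :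
    innerMass L A + innerMass L Aᶜ = L 1 := by
  have halg : IsSetAlgebra {A : Set Z | innerMass L A + innerMass L Aᶜ = L 1} :=
    { empty_mem := by simp [innerMass_empty, innerMass_univ]
      compl_mem := fun s hs => by
        simpa only [Set.mem_ofPred_eq, compl_compl, add_comm (innerMass L sᶜ)] using hs
      union_mem := fun s t hs ht => innerMass_add_compl_union L hs ht }
  refine halg.generateSetAlgebra_subset (fun F hF => ?_) hA
  refine le_antisymm (innerMass_add_compl_le L _) (le_of_forall_pos_le_add fun ε hε => ?_)
  obtain ⟨G, hG, hGF, h⟩ := exists_zeroSet_subset_compl L F hε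
  linarith [zeroSetMass_le_innerMass L hF subset_rfl, zeroSetMass_le_innerMass L hG hGF]

theorem innerMass_union (hA : A ∈ zeroSetAlgebra Z) (hB : B ∈ zeroSetAlgebra Z)
    (h : Disjoint A B) : innerMass L (A ∪ B) = innerMass L A + innerMass L B := by
  refine le_antisymm ?_ (innerMass_add_le_union L h)
  have hcompl := innerMass_supermodular L Aᶜ Bᶜ
  rw [← Set.compl_union] at hcompl
  linarith [innerMass_mono L (Set.subset_univ (Aᶜ ∪ Bᶜ)), innerMass_univ L,
    innerMass_add_compl L hA, innerMass_add_compl L hB, innerMass_add_compl_le L (A ∪ B)]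

/-- The regular charge that represents a normalized positive functional on the bounded continuous
functions (Alexandroff's theorem); its content is the inner mass. -/
def charge (hL : L 1 = 1) : ProbabilityCharge Z where
  content := isSetAlgebra_zeroSetAlgebra.isSetRing.addContent_of_union (innerMass L)
    (innerMass_empty L) (innerMass_union L)
  nonneg A _ := innerMass_nonneg L A
  regular A _ ε hε := by
    obtain ⟨F, hF, hFA, h⟩ := exists_innerMass_sub_lt L A hε
    refine ⟨F, hF, hFA, fun B _ hBA => ?_⟩
    have hunion : innerMass L F + innerMass L B ≤ innerMass L A :=
      (innerMass_add_le_union L (disjoint_sdiff_self_right.mono_right hBA)).trans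
        (innerMass_mono L (Set.union_subset hFA (hBA.trans Set.sdiff_subset)))
    rw [innerMass_of_zeroSet L hF] at hunion
    exact (abs_of_nonneg (innerMass_nonneg L B)).trans_lt (by linarith)
  mass := (innerMass_univ L).trans hL

end Representation

section Integral

variable {Z : Type*} [TopologicalSpace Z]

namespace ProbabilityCharge

variable (γ : ProbabilityCharge Z) {f g : Z → ℝ} {m M : ℝ}

theorem lowerSums_mono (h : ∀ z, f z ≤ g z) : γ.lowerSums f ⊆ γ.lowerSums g := by
  rintro _ ⟨n, A, a, hA, hd, hU, ha, rfl⟩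
  exact ⟨n, A, a, hA, hd, hU, fun i z hz => (ha i z hz).trans (h z), rfl⟩

theorem sum_content_eq_one {ι : Type*} [Fintype ι] {A : ι → Set Z}
    (hA : ∀ i, A i ∈ zeroSetAlgebra Z) (hd : Pairwise (Function.onFun Disjoint A))
    (hU : (⋃ i, A i) = Set.univ) : ∑ i, γ.content (A i) = 1 := by
  rw [← addContent_iUnion hA hd (hU ▸ isSetAlgebra_zeroSetAlgebra.univ_mem), hU, γ.mass]

theorem mem_lowerSums_of_le (h : ∀ z, m ≤ f z) : m ∈ γ.lowerSums f :=
  ⟨1, fun _ => Set.univ, fun _ => m, fun _ => isSetAlgebra_zeroSetAlgebra.univ_mem,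
    Subsingleton.pairwise, Set.iUnion_const _, fun _ z _ => h z, by simp [γ.mass]⟩

theorem bddAbove_lowerSums (h : ∀ z, f z ≤ M) : BddAbove (γ.lowerSums f) := by
  refine ⟨M, ?_⟩
  rintro _ ⟨n, A, a, hA, hd, hU, ha, rfl⟩
  calc ∑ i, a i * γ.content (A i) ≤ ∑ i, M * γ.content (A i) := Finset.sum_le_sum fun i _ => by
        rcases (A i).eq_empty_or_nonempty with he | ⟨z, hz⟩
        · simp [he]
        · exact mul_le_mul_of_nonneg_right ((ha i z hz).trans (h z)) (γ.nonneg _ (hA i))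
    _ = M := by rw [← Finset.mul_sum, γ.sum_content_eq_one hA hd hU, mul_one]

theorem integral_mono (hf : ∀ z, m ≤ f z) (hg : ∀ z, g z ≤ M) (h : ∀ z, f z ≤ g z) :
    γ.integral f ≤ γ.integral g :=
  csSup_le_csSup (γ.bddAbove_lowerSums hg) ⟨m, γ.mem_lowerSums_of_le hf⟩ (γ.lowerSums_mono h)

end ProbabilityCharge

variable (L : (Z →ᵇ ℝ) →ₚ[ℝ] ℝ) {f : Z →ᵇ ℝ}

theorem sum_mul_zeroSetMass_le {ι : Type*} (t : Finset ι) {F : ι → Set Z} {a : ι → ℝ}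
    (hF : ∀ i, F i ∈ zeroSets Z) (hd : Pairwise (Function.onFun Disjoint F))
    (ha : ∀ i, 0 ≤ a i) (h0 : 0 ≤ f) (h : ∀ i ∈ t, ∀ z ∈ F i, a i ≤ f z) :
    ∑ i ∈ t, a i * zeroSetMass L (F i) ≤ L f := by
  classical
  induction t using Finset.induction_on generalizing f with
  | empty => simpa using map_nonneg L h0
  | insert i t hi ih =>
    obtain ⟨s, s0, s1, s_i, s_t⟩ := exists_separating_of_disjoint_zeroSets (hF i)
      (biUnion_mem_zeroSets t fun j _ => hF j)
      (Set.disjoint_iUnion₂_right.mpr fun j hj => hd (ne_of_mem_of_not_mem hj hi).symm)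
    have hf_i : a i * zeroSetMass L (F i) ≤ L ((1 - s) * f) :=
      mul_zeroSetMass_le L (ha i) (fun z => mul_nonneg (sub_nonneg.mpr (s1 z)) (h0 z))
        fun z hz => by simpa [s_i z hz] using h i (Finset.mem_insert_self i t) z hz
    have hf_t : ∑ j ∈ t, a j * zeroSetMass L (F j) ≤ L (s * f) :=
      ih (fun z => mul_nonneg (s0 z) (h0 z)) fun j hj z hz => by
        simpa [s_t z (Set.mem_biUnion hj hz)] using h j (Finset.mem_insert_of_mem hj) z hz
    calc ∑ j ∈ insert i t, a j * zeroSetMass L (F j)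
        = a i * zeroSetMass L (F i) + ∑ j ∈ t, a j * zeroSetMass L (F j) :=
          Finset.sum_insert hi
      _ ≤ L ((1 - s) * f) + L (s * f) := add_le_add hf_i hf_t
      _ = L f := by rw [← map_add, ← add_mul, sub_add_cancel, one_mul]

theorem sum_mul_innerMass_le {ι : Type*} [Fintype ι] {A : ι → Set Z} {a : ι → ℝ}
    (hd : Pairwise (Function.onFun Disjoint A)) (ha : ∀ i, 0 ≤ a i) (h0 : 0 ≤ f)
    (h : ∀ i, ∀ z ∈ A i, a i ≤ f z) : ∑ i, a i * innerMass L (A i) ≤ L f := by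
  refine le_of_forall_pos_le_add fun ε hε => ?_
  obtain ⟨δ, hδ, hδε⟩ := exists_pos_mul_lt hε (∑ i, a i)
  choose F hF hFA hFm using fun i => exists_innerMass_sub_lt L (A i) hδ
  calc ∑ i, a i * innerMass L (A i) ≤ ∑ i, (a i * zeroSetMass L (F i) + a i * δ) :=
        Finset.sum_le_sum fun i _ => by
          rw [← mul_add]
          exact mul_le_mul_of_nonneg_left (sub_lt_iff_lt_add.mp (hFm i)).le (ha i)
    _ = ∑ i, a i * zeroSetMass L (F i) + (∑ i, a i) * δ := by
        rw [Finset.sum_add_distrib, Finset.sum_mul]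
    _ ≤ L f + ε := add_le_add
        (sum_mul_zeroSetMass_le L _ hF (fun i j hij => (hd hij).mono (hFA i) (hFA j)) ha h0
          fun i _ z hz => h i z (hFA i hz)) hδε.le

variable {L} (hL : L 1 = 1)
include hL

theorem apply_const_of_apply_one (r : ℝ) : L (.const Z r) = r := by
  have h : BoundedContinuousFunction.const Z r = r • 1 := by ext; simp
  rw [h, map_smul, hL, smul_eq_mul, mul_one]

theorem le_of_mem_lowerSums_charge {r : ℝ} (hr : r ∈ (charge L hL).lowerSums f) : r ≤ L f := by
  obtain ⟨n, A, a, hA, hd, hU, ha, rfl⟩ := hr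
  set C : ℝ := ‖f‖ + ∑ i, |a i|
  have hCa : ∀ i, 0 ≤ a i + C := fun i => by
    have := Finset.single_le_sum (fun j _ => abs_nonneg (a j)) (Finset.mem_univ i)
    linarith [neg_abs_le (a i), norm_nonneg f]
  have hC : ‖f‖ ≤ C := le_add_of_nonneg_right (Finset.sum_nonneg fun i _ => abs_nonneg (a i))
  have hCf : 0 ≤ f + .const Z C := fun z => by
    change 0 ≤ f z + C
    linarith [f.neg_norm_le_apply z]
  have h := sum_mul_innerMass_le L hd hCa hCf fun i z hz => by simpa using ha i z hz
  have hmass : ∑ i, innerMass L (A i) = 1 := (charge L hL).sum_content_eq_one hA hd hU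
  rw [map_add, apply_const_of_apply_one hL] at h
  simp_rw [add_mul, Finset.sum_add_distrib, ← Finset.mul_sum, hmass, mul_one] at h
  exact le_of_add_le_add_right h

theorem exists_mem_lowerSums_charge (f : Z →ᵇ ℝ) {ε : ℝ} (hε : 0 < ε) :
    ∃ r ∈ (charge L hL).lowerSums f, L f - ε ≤ r := by
  obtain ⟨n, A, a, hA, hd, hU, ha⟩ := exists_partition_oscillation_le f hε
  refine ⟨_, ⟨n, A, a, hA, hd, hU, fun i z hz => (ha i z hz).1, rfl⟩, ?_⟩
  have hneg : ∑ i, (-a i - ε) * (charge L hL).content (A i) ≤ L (-f) :=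
    le_of_mem_lowerSums_charge hL ⟨n, A, fun i => -a i - ε, hA, hd, hU, fun i z hz => by
      change -a i - ε ≤ -f z
      linarith [(ha i z hz).2], rfl⟩
  simp_rw [sub_mul, neg_mul, Finset.sum_sub_distrib, Finset.sum_neg_distrib, ← Finset.mul_sum,
    (charge L hL).sum_content_eq_one hA hd hU, map_neg] at hneg
  linarith

theorem integral_charge (f : Z →ᵇ ℝ) : (charge L hL).integral f = L f := by
  have hle : ∀ r ∈ (charge L hL).lowerSums f, r ≤ L f := fun r => le_of_mem_lowerSums_charge hL
  refine le_antisymm (csSup_le ⟨_, (charge L hL).mem_lowerSums_of_le f.neg_norm_le_apply⟩ hle)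
    (le_of_forall_pos_le_add fun ε hε => ?_)
  obtain ⟨r, hr, h⟩ := exists_mem_lowerSums_charge hL f hε
  exact (sub_le_iff_le_add.mp h).trans (add_le_add_left (le_csSup ⟨L f, hle⟩ hr) ε)

end Integral

section Komlos

theorem exists_cauchySeq_mem_of_antitone_convex {E : Type*} [NormedAddCommGroup E]
    [InnerProductSpace ℝ E] {K : ℕ → Set E} (hanti : Antitone K) (hconv : ∀ n, Convex ℝ (K n))
    (hne : ∀ n, (K n).Nonempty) (hbdd : Bornology.IsBounded (K 0)) :
    ∃ x : ℕ → E, (∀ n, x n ∈ K n) ∧ CauchySeq x := by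
  obtain ⟨C, hC⟩ := hbdd.exists_norm_le
  set s : ℕ → ℝ := fun n => sInf ((fun x => ‖x‖ ^ 2) '' K n)
  have hs_le : ∀ {n x}, x ∈ K n → s n ≤ ‖x‖ ^ 2 := fun hx =>
    csInf_le ⟨0, by rintro _ ⟨x, -, rfl⟩; positivity⟩ ⟨_, hx, rfl⟩
  have hs_mono : Monotone s := fun m n hmn =>
    le_csInf ((hne n).image _) (by rintro _ ⟨x, hx, rfl⟩; exact hs_le (hanti hmn hx))
  have hs_bdd : BddAbove (Set.range s) := ⟨C ^ 2, by
    rintro _ ⟨n, rfl⟩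
    obtain ⟨x, hx⟩ := hne n
    exact (hs_le hx).trans
      (pow_le_pow_left₀ (norm_nonneg x) (hC x (hanti (Nat.zero_le n) hx)) 2)⟩
  have hnear : ∀ n, ∃ x ∈ K n, ‖x‖ ^ 2 < s n + 1 / (n + 1) := fun n => by
    obtain ⟨_, ⟨x, hx, rfl⟩, h⟩ := exists_lt_of_csInf_lt ((hne n).image fun x => ‖x‖ ^ 2)
      (lt_add_of_pos_right (s n) (Nat.one_div_pos_of_nat (α := ℝ) (n := n)))
    exact ⟨x, hx, h⟩
  choose x hxK hx using hnear
  refine ⟨x, hxK, cauchySeq_of_le_tendsto_0'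
    (fun n => √(2 * ((⨆ k, s k) - s n) + 4 * (1 / (n + 1)))) (fun m n hmn => ?_) ?_⟩
  · have hmid : s m ≤ ‖(1 / 2 : ℝ) • x m + (1 / 2 : ℝ) • x n‖ ^ 2 :=
      hs_le (hconv m (hxK m) (hanti hmn (hxK n)) (by norm_num) (by norm_num) (by norm_num))
    rw [← smul_add, norm_smul, mul_pow] at hmid
    norm_num at hmid
    have hdecr : 1 / ((n : ℝ) + 1) ≤ 1 / (m + 1) := Nat.one_div_le_one_div hmn
    rw [dist_eq_norm]
    refine Real.le_sqrt_of_sq_le ?_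
    nlinarith [parallelogram_law_with_norm ℝ (x m) (x n), hx m, hx n, le_ciSup hs_bdd n]
  · have h := (((tendsto_atTop_ciSup hs_mono hs_bdd).const_sub (⨆ k, s k)).const_mul 2).add
      ((tendsto_one_div_add_atTop_nhds_zero_nat (𝕜 := ℝ)).const_mul 4)
    simpa using h.sqrt

theorem exists_seq_mem_tendsto_ae_of_antitone_convex {Ω F : Type*} {mΩ : MeasurableSpace Ω}
    {P : Measure Ω} [NormedAddCommGroup F] [InnerProductSpace ℝ F] [CompleteSpace F]
    {K : ℕ → Set (Ω → F)} (hanti : Antitone K) (hconv : ∀ n, Convex ℝ (K n))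
    (hne : ∀ n, (K n).Nonempty) (hmem : ∀ f ∈ K 0, MemLp f 2 P) {C : NNReal}
    (hC : ∀ f ∈ K 0, eLpNorm f 2 P ≤ C) :
    ∃ f : ℕ → Ω → F, (∀ n, f n ∈ K n) ∧
      ∀ᵐ ω ∂P, ∃ l, Tendsto (fun n => f n ω) atTop (𝓝 l) := by
  have h0 : ∀ {n f}, f ∈ K n → f ∈ K 0 := fun hf => hanti (Nat.zero_le _) hf
  obtain ⟨g, hgK, hg⟩ := exists_cauchySeq_mem_of_antitone_convex
    (K := fun n => {g : Lp F 2 P | ∃ f ∈ K n, g =ᵐ[P] f})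
    (fun m n hmn g ⟨f, hf, hgf⟩ => ⟨f, hanti hmn hf, hgf⟩)
    (fun n g ⟨f, hf, hgf⟩ g' ⟨f', hf', hgf'⟩ a b ha hb hab => by
      refine ⟨a • f + b • f', hconv n hf hf' ha hb hab, ?_⟩
      filter_upwards [Lp.coeFn_add (a • g) (b • g'), Lp.coeFn_smul a g, Lp.coeFn_smul b g', hgf,
        hgf'] with ω h1 h2 h3 h4 h5
      simp only [h1, Pi.add_apply, h2, h3, Pi.smul_apply, h4, h5])
    (fun n => (hne n).elim fun f hf => ⟨(hmem f (h0 hf)).toLp f, f, hf, MemLp.coeFn_toLp _⟩)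
    (isBounded_iff_forall_norm_le.mpr ⟨C, fun g ⟨f, hf, hgf⟩ => by
      rw [Lp.norm_def, eLpNorm_congr_ae hgf]
      exact ENNReal.toReal_le_coe_of_le_coe (hC f hf)⟩)
  choose f hfK hgf using hgK
  obtain ⟨l, hl⟩ := cauchySeq_tendsto_of_complete hg
  obtain ⟨κ, hκ, hae⟩ := (tendstoInMeasure_of_tendsto_Lp hl).exists_seq_tendsto_ae
  refine ⟨fun n => f (κ n), fun n => hanti (hκ.le_apply) (hfK (κ n)), ?_⟩
  filter_upwards [hae, ae_all_iff.mpr hgf] with ω hω hfω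
  exact ⟨l ω, by simpa only [hfω] using hω⟩

end Komlos

section BaireMeasures

variable {X : Type*} [TopologicalSpace X] [MeasurableSpace X] [BaireSigmaAlgebra X]

theorem measurable_of_continuous {f : X → ℝ} (hf : Continuous f) : Measurable f := by
  refine measurable_of_Iic fun a => ?_
  rw [BaireSigmaAlgebra.measurable_eq (X := X)]
  exact MeasurableSpace.measurableSet_generateFrom (setOf_le_mem_zeroSets hf a)

theorem integrable_boundedContinuous (μ : Measure X) [IsFiniteMeasure μ] (f : X →ᵇ ℝ) :
    Integrable f μ :=
  Integrable.of_bound (measurable_of_continuous f.continuous).aestronglyMeasurable ‖f‖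
    (Eventually.of_forall f.norm_coe_le_norm)

end BaireMeasures

section Transforms

variable {X Y : Type*}

/-- The pseudometric `sup_y |c(x, y) - c(x', y)|`, for which the transforms `ζ^c̄` are
`1`-Lipschitz. Property (H) says that it and its analogue on `Y`, which is
`costDist (c ∘ Prod.swap)`, are continuous. -/
def costDist (c : X × Y → ℝ) (x x' : X) : ℝ :=
  ⨆ y, |c (x, y) - c (x', y)|

variable {c : X × Y → ℝ} {M : ℝ}

theorem abs_comp_swap_le (hc : ∀ p, |c p| ≤ M) (p : Y × X) : |(c ∘ Prod.swap) p| ≤ M :=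
  hc p.swap

theorem abs_sub_le_costDist (hc : ∀ p, |c p| ≤ M) (x x' : X) (y : Y) :
    |c (x, y) - c (x', y)| ≤ costDist c x x' :=
  le_ciSup (f := fun y => |c (x, y) - c (x', y)|)
    ⟨M + M, by rintro _ ⟨y, rfl⟩; exact (abs_sub _ _).trans (add_le_add (hc _) (hc _))⟩ y

section Bounded

variable {ξ : X → ℝ} {K : ℝ} (hc : ∀ p, |c p| ≤ M) (hξ : ∀ x, |ξ x| ≤ K)
include hc hξ

theorem cTransform_le (x : X) (y : Y) : cTransform c ξ y ≤ c (x, y) - ξ x :=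
  ciInf_le (f := fun x => c (x, y) - ξ x) ⟨-M - K, by
    rintro _ ⟨x, rfl⟩
    exact sub_le_sub (neg_le_of_abs_le (hc _)) (le_of_abs_le (hξ x))⟩ x

variable [Nonempty X]

theorem abs_cTransform_le (y : Y) : |cTransform c ξ y| ≤ M + K := by
  obtain ⟨x₀⟩ := ‹Nonempty X›
  refine abs_le.mpr ⟨le_ciInf fun x => ?_, (cTransform_le hc hξ x₀ y).trans ?_⟩
  · linarith [neg_le_of_abs_le (hc (x, y)), le_of_abs_le (hξ x)]
  · linarith [le_of_abs_le (hc (x₀, y)), neg_le_of_abs_le (hξ x₀)]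

theorem cTransform_sub_le {y y' : Y} {r : ℝ} (h : ∀ x, c (x, y) - c (x, y') ≤ r) :
    cTransform c ξ y - cTransform c ξ y' ≤ r := by
  rw [sub_le_comm]
  exact le_ciInf fun x => by linarith [cTransform_le hc hξ x y, h x]

theorem abs_cTransform_sub_le_costDist (y y' : Y) :
    |cTransform c ξ y - cTransform c ξ y'| ≤ costDist (c ∘ Prod.swap) y y' := by
  have h := abs_sub_le_costDist (abs_comp_swap_le hc) y y'
  exact abs_sub_le_iff.mpr ⟨cTransform_sub_le hc hξ fun x => (abs_sub_le_iff.mp (h x)).1,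
    cTransform_sub_le hc hξ fun x => (abs_sub_le_iff.mp (h x)).2⟩

theorem abs_cTransform_sub_le (y y' : Y) : |cTransform c ξ y - cTransform c ξ y'| ≤ M + M := by
  have h : ∀ y y' x, c (x, y) - c (x, y') ≤ M + M := fun y y' x =>
    (le_abs_self _).trans ((abs_sub _ _).trans (add_le_add (hc _) (hc _)))
  exact abs_sub_le_iff.mpr ⟨cTransform_sub_le hc hξ (h y y'), cTransform_sub_le hc hξ (h y' y)⟩

end Bounded

theorem cBarTransform_eq_cTransform_swap (c : X × Y → ℝ) (ζ : Y → ℝ) :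
    cBarTransform c ζ = cTransform (c ∘ Prod.swap) ζ :=
  rfl

theorem cBarTransform_add_le (hc : ∀ p, |c p| ≤ M) {ζ : Y → ℝ} {K : ℝ} (hζ : ∀ y, |ζ y| ≤ K)
    (x : X) (y : Y) : cBarTransform c ζ x + ζ y ≤ c (x, y) :=
  le_sub_iff_add_le.mp (cTransform_le (abs_comp_swap_le hc) hζ y x)

variable [TopologicalSpace X] [TopologicalSpace Y]

theorem continuous_of_abs_sub_le_of_tendsto {f : X → ℝ} {d : X → X → ℝ}
    (hd : ∀ x₀, Tendsto (d · x₀) (𝓝 x₀) (𝓝 0)) (hf : ∀ x x', |f x - f x'| ≤ d x x') :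
    Continuous f :=
  continuous_iff_continuousAt.mpr fun x₀ => tendsto_iff_dist_tendsto_zero.mpr <|
    squeeze_zero (fun _ => dist_nonneg) (fun x => hf x x₀) (hd x₀)

namespace PropertyH

theorem swap (hH : PropertyH c) : PropertyH (c ∘ Prod.swap) :=
  ⟨hH.2, hH.1⟩

theorem continuous_of_abs_sub_le_costDist (hH : PropertyH c) {f : X → ℝ}
    (hf : ∀ x x', |f x - f x'| ≤ costDist c x x') : Continuous f :=
  continuous_of_abs_sub_le_of_tendsto hH.1 hf

theorem continuous (hc : ∀ p, |c p| ≤ M) (hH : PropertyH c) : Continuous c := by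
  refine continuous_of_abs_sub_le_of_tendsto
    (d := fun p p' => costDist c p.1 p'.1 + costDist (c ∘ Prod.swap) p.2 p'.2) (fun p₀ => ?_)
    fun p p' => (abs_sub_le _ (c (p'.1, p.2)) _).trans
      (add_le_add (abs_sub_le_costDist hc _ _ _)
        (abs_sub_le_costDist (abs_comp_swap_le hc) p.2 p'.2 p'.1))
  have h₁ : Tendsto (fun p : X × Y => costDist c p.1 p₀.1) (𝓝 p₀) (𝓝 0) :=
    (hH.1 p₀.1).comp continuousAt_fst
  have h₂ : Tendsto (fun p : X × Y => costDist (c ∘ Prod.swap) p.2 p₀.2) (𝓝 p₀) (𝓝 0) :=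
    (hH.2 p₀.2).comp continuousAt_snd
  simpa only [add_zero] using h₁.add h₂

theorem exists_boundedContinuous_eq_cTransform [Nonempty X] (hc : ∀ p, |c p| ≤ M)
    (hH : PropertyH c) (ξ : X →ᵇ ℝ) : ∃ ψ : Y →ᵇ ℝ, (ψ : Y → ℝ) = cTransform c ξ :=
  ⟨.ofNormedAddCommGroup (cTransform c ξ)
    (hH.swap.continuous_of_abs_sub_le_costDist
      (abs_cTransform_sub_le_costDist hc ξ.norm_coe_le_norm)) (M + ‖ξ‖)
    (abs_cTransform_le hc ξ.norm_coe_le_norm), rfl⟩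

end PropertyH

theorem dualAdmissible_nonempty (hc : ∀ p, |c p| ≤ M) : (dualAdmissible c).Nonempty :=
  ⟨(.const X (-M), 0), fun x y => by simpa using neg_le_of_abs_le (hc (x, y))⟩

theorem exists_cTransform_pair_mem_dualAdmissible [Nonempty X] [Nonempty Y]
    (hc : ∀ p, |c p| ≤ M) (hH : PropertyH c) {q : (X →ᵇ ℝ) × (Y →ᵇ ℝ)}
    (hq : q ∈ dualAdmissible c) :
    ∃ (φ : X →ᵇ ℝ) (ψ : Y →ᵇ ℝ), (φ : X → ℝ) = cBarTransform c (cTransform c q.1) ∧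
      (ψ : Y → ℝ) = cTransform c q.1 ∧ (φ, ψ) ∈ dualAdmissible c ∧ q ≤ (φ, ψ) := by
  obtain ⟨ψ, hψ⟩ := hH.exists_boundedContinuous_eq_cTransform hc q.1
  obtain ⟨φ, hφ⟩ := hH.swap.exists_boundedContinuous_eq_cTransform (abs_comp_swap_le hc) ψ
  rw [← cBarTransform_eq_cTransform_swap] at hφ
  refine ⟨φ, ψ, hψ ▸ hφ, hψ, fun x y => ?_, fun x => ?_, fun y => ?_⟩
  · simpa only [hφ] using cBarTransform_add_le hc ψ.norm_coe_le_norm x y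
  · change q.1 x ≤ φ x
    rw [hφ, hψ]
    exact le_ciInf fun y => le_sub_comm.mp (cTransform_le hc q.1.norm_coe_le_norm x y)
  · change q.2 y ≤ ψ y
    rw [hψ]
    exact le_ciInf fun x => le_sub_iff_add_le'.mpr (hq x y)

end Transforms

section DualObjective

variable {X Y : Type*} [TopologicalSpace X] [TopologicalSpace Y]

/-- The function `φ(x) + ψ(y)` on the product, as a linear function of the pair `(φ, ψ)`. -/
def separatedSum : (X →ᵇ ℝ) × (Y →ᵇ ℝ) →ₗ[ℝ] X × Y →ᵇ ℝ where
  toFun q := q.1.compContinuous ⟨Prod.fst, continuous_fst⟩ +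
    q.2.compContinuous ⟨Prod.snd, continuous_snd⟩
  map_add' q q' := by ext p; exact add_add_add_comm _ _ _ _
  map_smul' a q := by ext p; exact (mul_add _ _ _).symm

theorem separatedSum_apply (q : (X →ᵇ ℝ) × (Y →ᵇ ℝ)) (p : X × Y) :
    separatedSum q p = q.1 p.1 + q.2 p.2 :=
  rfl

variable [MeasurableSpace X] [MeasurableSpace Y]

theorem dualObjective_const_zero (μ : Measure X) [IsProbabilityMeasure μ] (ν : Measure Y) (a : ℝ) :
    dualObjective μ ν (.const X a, 0) = a := by
  simp [dualObjective]

variable [BaireSigmaAlgebra X] [BaireSigmaAlgebra Y]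

theorem isLinearMap_dualObjective (μ : Measure X) [IsFiniteMeasure μ] (ν : Measure Y)
    [IsFiniteMeasure ν] : IsLinearMap ℝ (dualObjective μ ν) where
  map_add q q' := by
    simp only [dualObjective, Prod.fst_add, Prod.snd_add, BoundedContinuousFunction.add_apply]
    rw [integral_add (integrable_boundedContinuous μ _) (integrable_boundedContinuous μ _),
      integral_add (integrable_boundedContinuous ν _) (integrable_boundedContinuous ν _),
      add_add_add_comm]
  map_smul a q := by
    simp only [dualObjective, Prod.smul_fst, Prod.smul_snd, BoundedContinuousFunction.smul_apply,
      smul_eq_mul, integral_const_mul, mul_add]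

theorem integrable_separatedSum (μ : Measure X) [IsFiniteMeasure μ] (ν : Measure Y)
    [IsFiniteMeasure ν] (q : (X →ᵇ ℝ) × (Y →ᵇ ℝ)) : Integrable (separatedSum q) (μ.prod ν) :=
  ((integrable_boundedContinuous μ q.1).comp_fst ν).add
    ((integrable_boundedContinuous ν q.2).comp_snd μ)

variable (μ : Measure X) [IsProbabilityMeasure μ] (ν : Measure Y) [IsProbabilityMeasure ν]

theorem integral_separatedSum (q : (X →ᵇ ℝ) × (Y →ᵇ ℝ)) :
    ∫ p, separatedSum q p ∂(μ.prod ν) = dualObjective μ ν q := by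
  simp only [separatedSum_apply]
  rw [integral_add ((integrable_boundedContinuous μ q.1).comp_fst ν)
    ((integrable_boundedContinuous ν q.2).comp_snd μ), integral_fun_fst, integral_fun_snd]
  simp [dualObjective]

theorem dualObjective_le_of_separatedSum_le {q q' : (X →ᵇ ℝ) × (Y →ᵇ ℝ)}
    (h : separatedSum q ≤ separatedSum q') : dualObjective μ ν q ≤ dualObjective μ ν q' := by
  rw [← integral_separatedSum, ← integral_separatedSum]
  exact integral_mono (integrable_separatedSum μ ν q) (integrable_separatedSum μ ν q') h

theorem dualObjective_mono : Monotone (dualObjective μ ν) := fun _ _ h =>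
  dualObjective_le_of_separatedSum_le μ ν fun p => add_le_add (h.1 p.1) (h.2 p.2)

theorem dualObjective_le_of_mem_dualAdmissible {c : X × Y → ℝ} {M : ℝ} (hc : ∀ p, c p ≤ M)
    {q : (X →ᵇ ℝ) × (Y →ᵇ ℝ)} (hq : q ∈ dualAdmissible c) : dualObjective μ ν q ≤ M := by
  rw [← dualObjective_const_zero μ ν M]
  exact dualObjective_le_of_separatedSum_le μ ν fun p => by
    simpa [separatedSum_apply] using (hq p.1 p.2).trans (hc p)

theorem bddAbove_dualObjective {c : X × Y → ℝ} {M : ℝ} (hc : ∀ p, c p ≤ M) :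
    BddAbove (dualObjective μ ν '' dualAdmissible c) :=
  ⟨M, Set.forall_mem_image.mpr fun _ hq => dualObjective_le_of_mem_dualAdmissible μ ν hc hq⟩

end DualObjective

section DualAttainment

variable {X Y : Type*} [TopologicalSpace X] [TopologicalSpace Y] {c : X × Y → ℝ} {M : ℝ}

/-- The admissible pairs with the a priori bounds of a suitably shifted pair `(ξ^{cc̄}, ξ^c)`, for a
cost bounded by `M`. They form a convex set on which the dual problem may be solved. -/
def normalizedPairs (c : X × Y → ℝ) (M : ℝ) : Set ((X →ᵇ ℝ) × (Y →ᵇ ℝ)) :=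
  {q | q ∈ dualAdmissible c ∧ (∀ x, |q.1 x| ≤ M + (M + M)) ∧ (∀ y, |q.2 y| ≤ M + M) ∧
    (∀ x x', |q.1 x - q.1 x'| ≤ costDist c x x') ∧
    ∀ y y', |q.2 y - q.2 y'| ≤ costDist (c ∘ Prod.swap) y y'}

theorem convex_dualAdmissible (c : X × Y → ℝ) : Convex ℝ (dualAdmissible c) := by
  intro q hq r hr a b ha hb hab x y
  convert convex_Iic (c (x, y)) (hq x y) (hr x y) ha hb hab using 1
  simp only [Prod.fst_add, Prod.snd_add, Prod.smul_fst, Prod.smul_snd, smul_eq_mul,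
    BoundedContinuousFunction.add_apply, BoundedContinuousFunction.smul_apply, Set.mem_Iic]
  ring_nf

theorem convex_normalizedPairs (c : X × Y → ℝ) (M : ℝ) : Convex ℝ (normalizedPairs c M) := by
  rintro q ⟨hq, hφ, hψ, hφ', hψ'⟩ r ⟨hr, hφr, hψr, hφr', hψr'⟩ a b ha hb hab
  have convex_abs_le : ∀ {s t C : ℝ}, |s| ≤ C → |t| ≤ C → |a * s + b * t| ≤ C :=
    fun {s t C} hs ht => by
      simpa using convex_closedBall (0 : ℝ) C (by simpa using hs) (by simpa using ht) ha hb hab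
  refine ⟨convex_dualAdmissible c hq hr ha hb hab, fun x => convex_abs_le (hφ x) (hφr x),
    fun y => convex_abs_le (hψ y) (hψr y), fun x x' => ?_, fun y y' => ?_⟩
  · convert convex_abs_le (hφ' x x') (hφr' x x') using 2
    simp only [Prod.fst_add, Prod.smul_fst, smul_eq_mul,
      BoundedContinuousFunction.add_apply, BoundedContinuousFunction.smul_apply]
    ring
  · convert convex_abs_le (hψ' y y') (hψr' y y') using 2
    simp only [Prod.snd_add, Prod.smul_snd, smul_eq_mul,
      BoundedContinuousFunction.add_apply, BoundedContinuousFunction.smul_apply]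
    ring

theorem abs_separatedSum_le {q : (X →ᵇ ℝ) × (Y →ᵇ ℝ)} (hq : q ∈ normalizedPairs c M) (p : X × Y) :
    |separatedSum q p| ≤ M + (M + M) + (M + M) :=
  (abs_add_le _ _).trans (add_le_add (hq.2.1 p.1) (hq.2.2.1 p.2))

theorem exists_mem_normalizedPairs_separatedSum_ge [Nonempty X] [Nonempty Y]
    (hc : ∀ p, |c p| ≤ M) (hH : PropertyH c) {q : (X →ᵇ ℝ) × (Y →ᵇ ℝ)}
    (hq : q ∈ dualAdmissible c) :
    ∃ q' ∈ normalizedPairs c M, separatedSum q ≤ separatedSum q' := by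
  obtain ⟨φ, ψ, hφ, hψ, hadm, hle⟩ := exists_cTransform_pair_mem_dualAdmissible hc hH hq
  rw [← hψ, cBarTransform_eq_cTransform_swap] at hφ
  obtain ⟨y₀⟩ := id ‹Nonempty Y›
  have hosc : ∀ y y', |ψ y - ψ y'| ≤ M + M := by
    simpa only [hψ] using abs_cTransform_sub_le hc q.1.norm_coe_le_norm
  have hφ_le : ∀ x, φ x + ψ y₀ ≤ M := fun x => (hadm x y₀).trans (le_of_abs_le (hc _))
  have le_hφ : ∀ x, -(M + (M + M)) - ψ y₀ ≤ φ x := fun x => hφ ▸ le_ciInf fun y => by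
    have := neg_le_of_abs_le (abs_comp_swap_le hc (y, x))
    linarith [le_of_abs_le (hosc y y₀)]
  refine ⟨(φ + .const X (ψ y₀), ψ - .const Y (ψ y₀)), ⟨fun x y => ?_, fun x => ?_,
    fun y => hosc y y₀, fun x x' => ?_, fun y y' => ?_⟩, fun p => ?_⟩
  · simpa using hadm x y
  · have := (abs_nonneg _).trans (hosc y₀ y₀)
    exact abs_le.mpr ⟨neg_le_iff_add_nonneg.mpr (by simpa using by linarith [le_hφ x]),
      (hφ_le x).trans (by linarith)⟩
  · simp only [BoundedContinuousFunction.add_apply, BoundedContinuousFunction.const_apply, hφ,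
      add_sub_add_right_eq_sub]
    exact abs_cTransform_sub_le_costDist (abs_comp_swap_le hc) ψ.norm_coe_le_norm x x'
  · simp only [BoundedContinuousFunction.sub_apply, BoundedContinuousFunction.const_apply, hψ,
      sub_sub_sub_cancel_right]
    exact abs_cTransform_sub_le_costDist hc q.1.norm_coe_le_norm y y'
  · simpa [separatedSum_apply] using add_le_add (hle.1 p.1) (hle.2 p.2)

theorem exists_tendsto_ultrafilter {ι : Type*} (u : Ultrafilter ι) {f : ι → ℝ} {C : ℝ}
    (hC : ∀ i, |f i| ≤ C) : ∃ l, |l| ≤ C ∧ Tendsto f u (𝓝 l) := by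
  obtain ⟨l, hl, h⟩ := (isCompact_Icc (a := -C) (b := C)).ultrafilter_le_nhds (u.map f)
    (le_principal_iff.mpr (u.mem_map.mpr (univ_mem' fun i => abs_le.mp (hC i))))
  exact ⟨l, abs_le.mpr hl, h⟩

theorem exists_boundedContinuous_tendsto_ultrafilter {ι : Type*} (u : Ultrafilter ι)
    {f : ι → X → ℝ} {C : ℝ} (hH : PropertyH c) (hC : ∀ i x, |f i x| ≤ C)
    (hf : ∀ i x x', |f i x - f i x'| ≤ costDist c x x') :
    ∃ g : X →ᵇ ℝ, ∀ x, Tendsto (f · x) u (𝓝 (g x)) := by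
  choose g hgC hg using fun x => exists_tendsto_ultrafilter u (hC · x)
  exact ⟨.ofNormedAddCommGroup g (hH.continuous_of_abs_sub_le_costDist fun x x' =>
    le_of_tendsto ((hg x).sub (hg x')).abs (.of_forall fun i => hf i x x')) C hgC, hg⟩

theorem exists_mem_dualAdmissible_tendsto_ultrafilter {ι : Type*} (u : Ultrafilter ι)
    {q : ι → (X →ᵇ ℝ) × (Y →ᵇ ℝ)} (hH : PropertyH c) (hq : ∀ i, q i ∈ normalizedPairs c M) :
    ∃ q' ∈ dualAdmissible c, ∀ p, Tendsto (fun i => separatedSum (q i) p) u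
      (𝓝 (separatedSum q' p)) := by
  obtain ⟨φ, hφ⟩ := exists_boundedContinuous_tendsto_ultrafilter u hH (fun i => (hq i).2.1)
    fun i => (hq i).2.2.2.1
  obtain ⟨ψ, hψ⟩ := exists_boundedContinuous_tendsto_ultrafilter u hH.swap
    (fun i => (hq i).2.2.1) fun i => (hq i).2.2.2.2
  exact ⟨(φ, ψ), fun x y => le_of_tendsto ((hφ x).add (hψ y)) (.of_forall fun i => (hq i).1 x y),
    fun p => (hφ p.1).add (hψ p.2)⟩

variable [MeasurableSpace X] [MeasurableSpace Y]

/-- The normalized pairs whose dual objective is within `1 / (n + 1)` of the dual value. -/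
def nearMaximizers (μ : Measure X) (ν : Measure Y) (c : X × Y → ℝ) (M : ℝ) (n : ℕ) :
    Set ((X →ᵇ ℝ) × (Y →ᵇ ℝ)) :=
  normalizedPairs c M ∩ {q | valueDP c μ ν - 1 / ((n : ℝ) + 1) ≤ dualObjective μ ν q}

theorem antitone_nearMaximizers (μ : Measure X) (ν : Measure Y) (c : X × Y → ℝ) (M : ℝ) :
    Antitone (nearMaximizers μ ν c M) :=
  fun _ _ h => Set.inter_subset_inter_right _ fun _ hq =>
    (sub_le_sub_left (Nat.one_div_le_one_div h) _).trans (Set.mem_ofPred.mp hq)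

variable [BaireSigmaAlgebra X] [BaireSigmaAlgebra Y]
  (μ : Measure X) [IsProbabilityMeasure μ] (ν : Measure Y) [IsProbabilityMeasure ν]

theorem nearMaximizers_nonempty [Nonempty X] [Nonempty Y] (hc : ∀ p, |c p| ≤ M)
    (hH : PropertyH c) (n : ℕ) : (nearMaximizers μ ν c M n).Nonempty := by
  obtain ⟨_, ⟨q, hq, rfl⟩, hlt⟩ := exists_lt_of_lt_csSup
    ((dualAdmissible_nonempty hc).image (dualObjective μ ν))
    (sub_lt_self (valueDP c μ ν) (Nat.one_div_pos_of_nat (n := n)))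
  obtain ⟨q', hq', hle⟩ := exists_mem_normalizedPairs_separatedSum_ge hc hH hq
  exact ⟨q', hq', hlt.le.trans (dualObjective_le_of_separatedSum_le μ ν hle)⟩

theorem convex_nearMaximizers (c : X × Y → ℝ) (M : ℝ) (n : ℕ) :
    Convex ℝ (nearMaximizers μ ν c M n) :=
  (convex_normalizedPairs c M).inter (convex_halfSpace_ge (isLinearMap_dualObjective μ ν) _)

theorem exists_seq_mem_nearMaximizers_tendsto_ae [Nonempty X] [Nonempty Y]
    (hc : ∀ p, |c p| ≤ M) (hH : PropertyH c) :
    ∃ q : ℕ → (X →ᵇ ℝ) × (Y →ᵇ ℝ), (∀ n, q n ∈ nearMaximizers μ ν c M n) ∧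
      ∀ᵐ p ∂(μ.prod ν), ∃ l, Tendsto (fun n => separatedSum (q n) p) atTop (𝓝 l) := by
  let toFun : (X →ᵇ ℝ) × (Y →ᵇ ℝ) → X × Y → ℝ := fun q => separatedSum q
  have toFun_linear : IsLinearMap ℝ toFun :=
    ⟨fun _ _ => by simp only [toFun, map_add]; rfl, fun _ _ => by simp only [toFun, map_smul]; rfl⟩
  have hbound : ∀ f ∈ toFun '' nearMaximizers μ ν c M 0,
      AEStronglyMeasurable f (μ.prod ν) ∧ ∀ᵐ p ∂(μ.prod ν), ‖f p‖ ≤ M + (M + M) + (M + M) := by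
    rintro _ ⟨q, hq, rfl⟩
    exact ⟨(integrable_separatedSum μ ν q).aestronglyMeasurable,
      .of_forall (abs_separatedSum_le hq.1)⟩
  obtain ⟨f, hf, hconv⟩ := exists_seq_mem_tendsto_ae_of_antitone_convex (P := μ.prod ν)
    (K := fun n => toFun '' nearMaximizers μ ν c M n)
    (C := (M + (M + M) + (M + M)).toNNReal)
    (fun _ _ h => Set.image_mono (antitone_nearMaximizers μ ν c M h))
    (fun n => (convex_nearMaximizers μ ν c M n).is_linear_image toFun_linear)
    (fun n => (nearMaximizers_nonempty μ ν hc hH n).image _)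
    (fun f hf => .of_bound (hbound f hf).1 _ (hbound f hf).2)
    (fun f hf => by simpa [ENNReal.ofReal] using eLpNorm_le_of_ae_bound (p := 2) (hbound f hf).2)
  choose q hq hqf using hf
  exact ⟨q, hq, by simpa only [← hqf] using hconv⟩

theorem exists_isMaxOn_dualObjective [Nonempty X] [Nonempty Y] (hc : ∀ p, |c p| ≤ M)
    (hH : PropertyH c) :
    ∃ q ∈ dualAdmissible c, IsMaxOn (dualObjective μ ν) (dualAdmissible c) q := by
  obtain ⟨q, hq, hconv⟩ := exists_seq_mem_nearMaximizers_tendsto_ae μ ν hc hH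
  obtain ⟨q', hq', hlim⟩ := exists_mem_dualAdmissible_tendsto_ultrafilter (hyperfilter ℕ) hH
    fun n => (hq n).1
  have hobjective :
      Tendsto (fun n => dualObjective μ ν (q n)) atTop (𝓝 (dualObjective μ ν q')) := by
    simp only [← integral_separatedSum μ ν]
    refine tendsto_integral_of_dominated_convergence (fun _ => M + (M + M) + (M + M))
      (fun n => (integrable_separatedSum μ ν (q n)).aestronglyMeasurable) (integrable_const _)
      (fun n => .of_forall (abs_separatedSum_le (hq n).1)) ?_
    filter_upwards [hconv] with p ⟨l, hl⟩
    rwa [← tendsto_nhds_unique (hl.mono_left Nat.hyperfilter_le_atTop) (hlim p)]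
  have hvalue : Tendsto (fun n : ℕ => valueDP c μ ν - 1 / ((n : ℝ) + 1)) atTop
      (𝓝 (valueDP c μ ν)) := by
    simpa using (tendsto_const_nhds (x := valueDP c μ ν)).sub
      tendsto_one_div_add_atTop_nhds_zero_nat
  refine ⟨q', hq', fun r hr => ?_⟩
  exact (le_csSup (bddAbove_dualObjective μ ν fun p => le_of_abs_le (hc p)) ⟨r, hr, rfl⟩).trans
    (le_of_tendsto_of_tendsto' hvalue hobjective fun n => (hq n).2)

end DualAttainment

section HahnBanach

theorem apply_zero_of_posHomogeneous {E : Type*} [AddCommGroup E] [Module ℝ E] {P : E → ℝ}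
    (P_smul : ∀ t : ℝ, 0 < t → ∀ x, P (t • x) = t * P x) : P 0 = 0 := by
  have h := P_smul 2 two_pos 0
  rw [smul_zero] at h
  linarith

theorem apply_smul_le_mul_of_superlinear {E : Type*} [AddCommGroup E] [Module ℝ E] {P : E → ℝ}
    (P_smul : ∀ t : ℝ, 0 < t → ∀ x, P (t • x) = t * P x) (P_add : ∀ x y, P x + P y ≤ P (x + y))
    (t : ℝ) (x : E) : P (t • x) ≤ t * P x := by
  have P_zero := apply_zero_of_posHomogeneous P_smul
  rcases lt_trichotomy t 0 with ht | rfl | ht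
  · have h := P_add (t • x) (-(t • x))
    rw [add_neg_cancel, P_zero, ← neg_smul, P_smul (-t) (neg_pos.mpr ht)] at h
    linarith
  · rw [zero_smul, zero_mul, P_zero]
  · exact (P_smul t ht x).le

theorem exists_linearMap_ge_apply_eq {E : Type*} [AddCommGroup E] [Module ℝ E] {P : E → ℝ}
    (P_smul : ∀ t : ℝ, 0 < t → ∀ x, P (t • x) = t * P x) (P_add : ∀ x y, P x + P y ≤ P (x + y))
    (x : E) : ∃ L : E →ₗ[ℝ] ℝ, (∀ y, P y ≤ L y) ∧ L x = P x := by
  have P_smul_le := apply_smul_le_mul_of_superlinear P_smul P_add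
  have hx : ∀ t : ℝ, t • x = 0 → t • P x = 0 := fun t ht => by
    rcases smul_eq_zero.mp ht with rfl | rfl
    · exact zero_smul ℝ _
    · rw [apply_zero_of_posHomogeneous P_smul, smul_zero]
  obtain ⟨L, hLx, hL⟩ := exists_extension_of_le_sublinear
    (LinearPMap.mkSpanSingleton' x (P x) hx) (fun y => -P (-y))
    (fun t ht y => by rw [← smul_neg, P_smul t ht, mul_neg])
    (fun y z => by rw [neg_add]; linarith [P_add (-y) (-z)])
    (by
      rintro ⟨y, hy⟩
      obtain ⟨t, rfl⟩ := Submodule.mem_span_singleton.mp hy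
      rw [LinearPMap.mkSpanSingleton'_apply, ← neg_smul]
      exact le_neg_of_le_neg ((P_smul_le (-t) x).trans_eq (neg_mul _ _)))
  refine ⟨L, fun y => ?_, ?_⟩
  · simpa using hL (-y)
  · exact (hLx ⟨x, Submodule.mem_span_singleton_self x⟩).trans
      (LinearPMap.mkSpanSingleton'_apply_self x (P x) hx _)

end HahnBanach

section Duality

variable {X Y : Type*} [TopologicalSpace X] [TopologicalSpace Y]

theorem add_mem_dualAdmissible {c c' : X × Y → ℝ} {q q' : (X →ᵇ ℝ) × (Y →ᵇ ℝ)}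
    (hq : q ∈ dualAdmissible c) (hq' : q' ∈ dualAdmissible c') :
    q + q' ∈ dualAdmissible (c + c') := fun x y =>
  (add_add_add_comm _ _ _ _).trans_le (add_le_add (hq x y) (hq' x y))

theorem smul_mem_dualAdmissible {c : X × Y → ℝ} {q : (X →ᵇ ℝ) × (Y →ᵇ ℝ)} {t : ℝ} (ht : 0 ≤ t)
    (hq : q ∈ dualAdmissible c) : t • q ∈ dualAdmissible (t • c) := fun x y =>
  (mul_add _ _ _).symm.trans_le (mul_le_mul_of_nonneg_left (hq x y) ht)

open scoped Pointwise in
theorem dualAdmissible_smul (c : X × Y → ℝ) {t : ℝ} (ht : 0 < t) :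
    dualAdmissible (t • c) = t • dualAdmissible c := by
  refine Set.Subset.antisymm (fun q hq => ?_) ?_
  · refine ⟨t⁻¹ • q, ?_, smul_inv_smul₀ ht.ne' q⟩
    simpa only [inv_smul_smul₀ ht.ne'] using smul_mem_dualAdmissible (inv_pos.mpr ht).le hq
  · rintro _ ⟨q, hq, rfl⟩
    exact smul_mem_dualAdmissible ht.le hq

variable [MeasurableSpace X] [MeasurableSpace Y]

theorem dualObjective_le_integral {μ : Measure X} {ν : Measure Y} {c : X × Y → ℝ} {M : ℝ}
    (hc : ∀ p, c p ≤ M) {γ : ProbabilityCharge (X × Y)} (hγ : γ ∈ plans μ ν)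
    {q : (X →ᵇ ℝ) × (Y →ᵇ ℝ)} (hq : q ∈ dualAdmissible c) :
    dualObjective μ ν q ≤ γ.integral c :=
  (hγ q.1 q.2).symm.trans_le <| γ.integral_mono
    (fun p => neg_le_of_abs_le ((separatedSum q).norm_coe_le_norm p)) hc fun p => hq p.1 p.2

variable [BaireSigmaAlgebra X] [BaireSigmaAlgebra Y]
  (μ : Measure X) [IsProbabilityMeasure μ] (ν : Measure Y) [IsProbabilityMeasure ν]

open scoped Pointwise in
theorem valueDP_smul (c : X × Y → ℝ) {t : ℝ} (ht : 0 < t) :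
    valueDP (t • c) μ ν = t * valueDP c μ ν := by
  rw [valueDP, valueDP, dualAdmissible_smul c ht, ← smul_eq_mul, ← Real.sSup_smul_of_nonneg ht.le]
  congr 1
  exact Set.image_smul_comm _ _ _ ((isLinearMap_dualObjective μ ν).map_smul t)

theorem dualObjective_le_valueDP {c : X × Y → ℝ} {M : ℝ} (hc : ∀ p, c p ≤ M)
    {q : (X →ᵇ ℝ) × (Y →ᵇ ℝ)} (hq : q ∈ dualAdmissible c) : dualObjective μ ν q ≤ valueDP c μ ν :=
  le_csSup (bddAbove_dualObjective μ ν hc) ⟨q, hq, rfl⟩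

theorem valueDP_add_le {c c' : X × Y → ℝ} {M M' : ℝ} (hc : ∀ p, |c p| ≤ M)
    (hc' : ∀ p, |c' p| ≤ M') : valueDP c μ ν + valueDP c' μ ν ≤ valueDP (c + c') μ ν := by
  rw [← le_sub_iff_add_le]
  refine csSup_le ((dualAdmissible_nonempty hc).image _) (Set.forall_mem_image.mpr fun q hq => ?_)
  rw [le_sub_comm]
  refine csSup_le ((dualAdmissible_nonempty hc').image _)
    (Set.forall_mem_image.mpr fun q' hq' => ?_)
  rw [le_sub_iff_add_le', ← (isLinearMap_dualObjective μ ν).map_add]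
  exact dualObjective_le_valueDP μ ν
    (fun p => add_le_add (le_of_abs_le (hc p)) (le_of_abs_le (hc' p)))
    (add_mem_dualAdmissible hq hq')

/-- Since `q` and `-q` are admissible for the costs `separatedSum q` and `separatedSum (-q)`, a
linear `L ≥ v_max(DP)` has the prescribed marginals. -/
theorem apply_separatedSum_of_valueDP_le {L : (X × Y →ᵇ ℝ) →ₗ[ℝ] ℝ}
    (hL : ∀ f : X × Y →ᵇ ℝ, valueDP f μ ν ≤ L f) (q : (X →ᵇ ℝ) × (Y →ᵇ ℝ)) :
    L (separatedSum q) = dualObjective μ ν q := by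
  have hle : ∀ q, dualObjective μ ν q ≤ L (separatedSum q) := fun q =>
    (dualObjective_le_valueDP μ ν (fun p => le_of_abs_le ((separatedSum q).norm_coe_le_norm p))
      fun _ _ => le_rfl).trans (hL _)
  refine (hle q).antisymm' ?_
  have h := hle (-q)
  rwa [(isLinearMap_dualObjective μ ν).map_neg, map_neg, map_neg, neg_le_neg_iff] at h

theorem apply_nonneg_of_valueDP_le {L : (X × Y →ᵇ ℝ) →ₗ[ℝ] ℝ}
    (hL : ∀ f : X × Y →ᵇ ℝ, valueDP f μ ν ≤ L f) {f : X × Y →ᵇ ℝ} (hf : 0 ≤ f) : 0 ≤ L f := by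
  refine le_trans ?_ (hL f)
  rw [← (isLinearMap_dualObjective μ ν).map_zero]
  exact dualObjective_le_valueDP μ ν (fun p => le_of_abs_le (f.norm_coe_le_norm p))
    fun x y => by simpa using hf (x, y)

theorem exists_mem_plans_integral_eq_valueDP (c : X × Y →ᵇ ℝ) :
    ∃ γ ∈ plans μ ν, γ.integral c = valueDP c μ ν := by
  obtain ⟨L, hL, hLc⟩ := exists_linearMap_ge_apply_eq
    (P := fun f : X × Y →ᵇ ℝ => valueDP f μ ν) (fun t ht f => valueDP_smul μ ν f ht)
    (fun f g => valueDP_add_le μ ν f.norm_coe_le_norm g.norm_coe_le_norm) c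
  have hmarg := apply_separatedSum_of_valueDP_le μ ν hL
  have hone : L 1 = 1 := by
    have h := hmarg (.const X 1, 0)
    rw [dualObjective_const_zero] at h
    convert h using 2
    ext p
    simp [separatedSum_apply]
  let L' := PositiveLinearMap.mk₀ L fun f hf => apply_nonneg_of_valueDP_le μ ν hL hf
  exact ⟨charge L' hone,
    fun φ ψ => (integral_charge hone (separatedSum (φ, ψ))).trans (hmarg (φ, ψ)),
    (integral_charge hone c).trans hLc⟩

end Duality

end BaireTransport

end

theorem corollary3_general {X Y : Type*} [TopologicalSpace X] [TopologicalSpace Y]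
    [MeasurableSpace X] [BaireSigmaAlgebra X] [MeasurableSpace Y] [BaireSigmaAlgebra Y]
    (c : X × Y → ℝ) (hc : ∃ M : ℝ, ∀ p, |c p| ≤ M) (hH : PropertyH c)
    (μ : Measure X) [IsProbabilityMeasure μ] (ν : Measure Y) [IsProbabilityMeasure ν] :
    ∃ γ ∈ plans μ ν, ∃ (ξ₀ : X →ᵇ ℝ) (φ : X →ᵇ ℝ) (ψ : Y →ᵇ ℝ),
      (∀ γ' ∈ plans μ ν, γ.integral c ≤ γ'.integral c) ∧
      (φ : X → ℝ) = cBarTransform c (cTransform c ξ₀) ∧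
      (ψ : Y → ℝ) = cTransform c ξ₀ ∧
      (φ, ψ) ∈ dualAdmissible c ∧
      (∀ q ∈ dualAdmissible c, dualObjective μ ν q ≤ dualObjective μ ν (φ, ψ)) ∧
      ∫ x, φ x ∂μ + ∫ y, ψ y ∂ν = valueDP c μ ν ∧
      valueDP c μ ν = valueOP c μ ν ∧
      valueOP c μ ν = γ.integral c := by
  obtain ⟨M, hM⟩ := hc
  have := nonempty_of_isProbabilityMeasure μ
  have := nonempty_of_isProbabilityMeasure ν
  have le_hM : ∀ p, c p ≤ M := fun p => le_of_abs_le (hM p)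
  obtain ⟨⟨ξ₀, ζ₀⟩, hq, hmax⟩ := exists_isMaxOn_dualObjective μ ν hM hH
  obtain ⟨φ, ψ, hφ, hψ, hadm, hle⟩ := exists_cTransform_pair_mem_dualAdmissible hM hH hq
  have hmax' : ∀ q ∈ dualAdmissible c, dualObjective μ ν q ≤ dualObjective μ ν (φ, ψ) :=
    fun q hq => (hmax hq).trans (dualObjective_mono μ ν hle)
  have hDP : valueDP c μ ν = dualObjective μ ν (φ, ψ) :=
    IsGreatest.csSup_eq ⟨⟨_, hadm, rfl⟩, Set.forall_mem_image.mpr hmax'⟩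
  obtain ⟨γ, hγ, hγc⟩ := exists_mem_plans_integral_eq_valueDP μ ν
    (.ofNormedAddCommGroup c (hH.continuous hM) M hM)
  have hmin : ∀ γ' ∈ plans μ ν, γ.integral c ≤ γ'.integral c := fun γ' hγ' =>
    (hγc.trans hDP).trans_le (dualObjective_le_integral le_hM hγ' hadm)
  have hOP : valueOP c μ ν = γ.integral c :=
    IsLeast.csInf_eq ⟨⟨γ, hγ, rfl⟩, Set.forall_mem_image.mpr hmin⟩
  exact ⟨γ, hγ, ξ₀, φ, ψ, hmin, hφ, hψ, hadm, hmax', hDP.symm, hγc.symm.trans hOP.symm, hOP⟩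

theorem corollary3 {X Y : Type*} [TopologicalSpace X] [T35Space X] [TopologicalSpace Y]
    [T35Space Y] [MeasurableSpace X] [BaireSigmaAlgebra X] [MeasurableSpace Y]
    [BaireSigmaAlgebra Y] (c : X × Y → ℝ) (hc : ∃ M : ℝ, ∀ p, |c p| ≤ M) (hH : PropertyH c)
    (μ : Measure X) [IsProbabilityMeasure μ] (hμ : IsSeparableMeasure μ)
    (ν : Measure Y) [IsProbabilityMeasure ν] (hν : IsSeparableMeasure ν) :
    ∃ γ ∈ plans μ ν, ∃ (ξ₀ : X →ᵇ ℝ) (φ : X →ᵇ ℝ) (ψ : Y →ᵇ ℝ),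
      (∀ γ' ∈ plans μ ν, γ.integral c ≤ γ'.integral c) ∧
      (φ : X → ℝ) = cBarTransform c (cTransform c ξ₀) ∧
      (ψ : Y → ℝ) = cTransform c ξ₀ ∧
      (φ, ψ) ∈ dualAdmissible c ∧
      (∀ q ∈ dualAdmissible c, dualObjective μ ν q ≤ dualObjective μ ν (φ, ψ)) ∧
      ∫ x, φ x ∂μ + ∫ y, ψ y ∂ν = valueDP c μ ν ∧
      valueDP c μ ν = valueOP c μ ν ∧
      valueOP c μ ν = γ.integral c :=
  corollary3_general c hc hH μ ν
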